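/- Let $M$ be a nonempty smooth manifold of dimension $n>1$, let $TM$ be its tangent bundle and $\hat TM=TM\setminus\{0\}$ the tangent bundle with the zero section removed, with induced local coordinates $(x^i,y^i)$. Let $\mathbb C=y^i\,\partial/\partial y^i$ be the Liouville vector field and $J=\partial/\partial y^i\otimes dx^i$ the tangent structure. A *spray* is a smooth vector field $S$ on $\hat TM$ with $JS=\mathbb C$ and $[\mathbb C,S]=S$. A *Finsler function* is a continuous function $F:TM\to\mathbb R$ that is smooth and positive on $\hat TM$, zero on the zero section, satisfies $F(x,cy)=cF(x,y)$ for all $c>0$, and whose metric tensor $g_{ij}=\frac12\,\partial^2F^2/\partial y^i\partial y^j$ has rank $n$ at every point of $\hat TM$. Its *geodesic spray* is the unique spray $S$ with $$i_S\,dd_JF^2=-dF^2 \quad\text{on } \hat TM,\qquad\text{where } d_JF^2=\frac{\partial F^2}{\partial y^i}\,dx^i .$$ A spray is *Finsler metrizable* if it is the geodesic spray of some Finsler function on $TM$. For a spray $S$ let $h=\frac12(\mathrm{Id}-[S,J])$ and $v=\frac12(\mathrm{Id}+[S,J])$ be its horizontal and vertical projectors and $\Phi=v\circ[S,h]$ its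 Jacobi endomorphism (the brackets are Frölicher–Nijenhuis brackets); a real number $\kappa$ is an eigenvalue of $\Phi$ at $u\in\hat TM$ if $\Phi(X)=\kappa JX$ for some nonzero horizontal vector $X$ at $u$. **Theorem.** Let $S$ be the geodesic spray of a Finsler function $F$ on $M$. Then the projective deformation $\widetilde S_\lambda=S-2\lambda F\,\mathbb C$ is not Finsler metrizable for almost every $\lambda\in\mathbb R$: the set of $\lambda\in\mathbb R$ for which $\widetilde S_\lambda$ is Finsler metrizable is finite. More precisely, let $u\in\hat TM$ be any point. Then only finitely many $\lambda\in\mathbb R$ satisfy $\lambda=0$ or $\lambda^2F(u)^2+\kappa=0$ for some eigenvalue $\kappa$ of the Jacobi endomorphism of $S$ at $u$, and for every other $\lambda$ the spray $\widetilde S_\lambda$ is not Finsler metrizable. -/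

import Mathlib

open scoped Manifold ContDiff

noncomputable section

namespace FinslerSpray

section ModelSpace

/-! Canonical structures and tensors on `E × E`, with coordinates `z = (x, y)`: the form which the
structures of `TM` take in the chart of `TM` induced by a chart of `M`. -/

variable {E : Type*} [NormedAddCommGroup E] [NormedSpace ℝ E]

/-- The tangent structure `J = ∂/∂yⁱ ⊗ dxⁱ`, that is `J (a, b) = (0, a)`. -/
def tangentStructure : (E × E) →L[ℝ] (E × E) :=
  (ContinuousLinearMap.inr ℝ E E).comp (ContinuousLinearMap.fst ℝ E E)

/-- The Liouville vector field `yⁱ ∂/∂yⁱ` in induced coordinates. -/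
def localLiouville (z : E × E) : E × E := (0, z.2)

/-- The Frölicher-Nijenhuis bracket `[S, A]` of a vector field `S` and a field of endomorphisms
`A`, characterised by `[S, A] X = [S, A X] - A [S, X]`. On a constant field `X` the right hand side
is `(D_S A) X - DS (A X) + A (DS X)`. -/
def bracketEnd {V : Type*} [NormedAddCommGroup V] [NormedSpace ℝ V]
    (S : V → V) (A : V → V →L[ℝ] V) (z : V) : V →L[ℝ] V :=
  fderiv ℝ A z (S z) - (fderiv ℝ S z).comp (A z) + (A z).comp (fderiv ℝ S z)

/-- The horizontal projector `h = (Id - [S, J]) / 2`. -/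
def horizontalProj (S : E × E → E × E) (z : E × E) : (E × E) →L[ℝ] (E × E) :=
  (1 / 2 : ℝ) • (ContinuousLinearMap.id ℝ (E × E) - bracketEnd S (fun _ => tangentStructure) z)

/-- The vertical projector `v = (Id + [S, J]) / 2`. -/
def verticalProj (S : E × E → E × E) (z : E × E) : (E × E) →L[ℝ] (E × E) :=
  (1 / 2 : ℝ) • (ContinuousLinearMap.id ℝ (E × E) + bracketEnd S (fun _ => tangentStructure) z)

/-- The Jacobi endomorphism `Φ = v ∘ [S, h]`. -/
def jacobiEnd (S : E × E → E × E) (z : E × E) : (E × E) →L[ℝ] (E × E) :=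
  (verticalProj S z).comp (bracketEnd S (horizontalProj S) z)

/-- The semi-basic one-form `d_J L = (∂L/∂yⁱ) dxⁱ`, that is `(d_J L) ξ = dL (J ξ)`. -/
def dJ (L : E × E → ℝ) (z : E × E) : (E × E) →L[ℝ] ℝ :=
  (fderiv ℝ L z).comp tangentStructure

/-- The exterior derivative of a one-form, `(dα)(ξ, η) = (D_ξ α) η - (D_η α) ξ`. -/
def extDerivOne {V : Type*} [NormedAddCommGroup V] [NormedSpace ℝ V]
    (α : V → V →L[ℝ] ℝ) (z ξ η : V) : ℝ :=
  fderiv ℝ α z ξ η - fderiv ℝ α z η ξ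

end ModelSpace

section Manifold

variable {E : Type*} [NormedAddCommGroup E] [NormedSpace ℝ E]
  {M : Type*} [TopologicalSpace M] [ChartedSpace E M] [IsManifold 𝓘(ℝ, E) ∞ M]

/-- The slashed tangent bundle: `TM` with the zero section removed. -/
def slashed (E : Type*) [NormedAddCommGroup E] [NormedSpace ℝ E]
    (M : Type*) [TopologicalSpace M] [ChartedSpace E M] :
    Set (TangentBundle 𝓘(ℝ, E) M) :=
  {u | u.2 ≠ 0}

variable (M) in
/-- Vector fields along `TM`. A vector field on the slashed tangent bundle is represented by such
a field whose values on the zero section are irrelevant: they are never used. -/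
abbrev VField : Type _ :=
  (u : TangentBundle 𝓘(ℝ, E) M) → TangentSpace (𝓘(ℝ, E).tangent) u

/-- The chart `(x, y)` of `TM` induced by the chart of `M` at `p`. -/
def tangentChart (p : M) : PartialEquiv (TangentBundle 𝓘(ℝ, E) M) (E × E) :=
  extChartAt (𝓘(ℝ, E).tangent) (⟨p, 0⟩ : TangentBundle 𝓘(ℝ, E) M)

/-- The part of the slashed tangent bundle covered by the induced chart at `p`, in coordinates. -/
def chartDomain (E : Type*) [NormedAddCommGroup E] [NormedSpace ℝ E]
    {M : Type*} [TopologicalSpace M] [ChartedSpace E M] [IsManifold 𝓘(ℝ, E) ∞ M] (p : M) :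
    Set (E × E) :=
  {z | z ∈ (tangentChart (E := E) p).target ∧ z.2 ≠ 0}

/-- A vector field on `TM` written in the induced chart at `p`. -/
def localField (S : VField (E := E) M) (p : M) (z : E × E) : E × E :=
  mfderiv (𝓘(ℝ, E).tangent) 𝓘(ℝ, E × E) (tangentChart (E := E) p)
    ((tangentChart (E := E) p).symm z) (S ((tangentChart (E := E) p).symm z))

/-- A function on `TM` written in the induced chart at `p`. -/
def localFun (L : TangentBundle 𝓘(ℝ, E) M → ℝ) (p : M) (z : E × E) : ℝ :=
  L ((tangentChart (E := E) p).symm z)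

/-- The Liouville vector field: at `u = (x, y)` it is the velocity at `y` of the vector `y` under
the inclusion of the fibre `T_x M` in `TM`. -/
def liouville : VField (E := E) M := fun u =>
  mfderiv 𝓘(ℝ, E) (𝓘(ℝ, E).tangent)
    (fun w : E => (⟨u.1, w⟩ : TangentBundle 𝓘(ℝ, E) M)) u.2 u.2

/-- A spray: a smooth vector field on the slashed tangent bundle with `J S = ℂ` and `[ℂ, S] = S`,
where `ℂ` is the Liouville vector field. -/
structure IsSpray (S : VField (E := E) M) : Prop where
  smooth : ∀ p : M, ContDiffOn ℝ ∞ (localField S p) (chartDomain E p)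
  semispray : ∀ p : M, ∀ z ∈ chartDomain E p,
    tangentStructure (localField S p z) = localLiouville z
  homogeneous : ∀ p : M, ∀ z ∈ chartDomain E p,
    VectorField.lieBracket ℝ localLiouville (localField S p) z = localField S p z

/-- The metric tensor `g_{ij} = (1/2) ∂²F²/∂yⁱ∂yʲ` at `(x, y)`, a bilinear form on `T_x M`. -/
def metricTensor (F : TangentBundle 𝓘(ℝ, E) M → ℝ) (x : M) (y : E) : E →L[ℝ] E →L[ℝ] ℝ :=
  (1 / 2 : ℝ) • fderiv ℝ (fderiv ℝ (fun w : E => F ⟨x, w⟩ ^ 2)) y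

/-- Finsler functions. The last condition says that the metric tensor has full rank. -/
structure IsFinslerFunction (F : TangentBundle 𝓘(ℝ, E) M → ℝ) : Prop where
  continuous : Continuous F
  smooth : ContMDiffOn (𝓘(ℝ, E).tangent) 𝓘(ℝ, ℝ) ∞ F (slashed E M)
  pos : ∀ u ∈ slashed E M, 0 < F u
  zero : ∀ x : M, F ⟨x, 0⟩ = 0
  homogeneous : ∀ c : ℝ, 0 < c → ∀ u : TangentBundle 𝓘(ℝ, E) M, F ⟨u.1, c • u.2⟩ = c * F u
  nondegenerate : ∀ u ∈ slashed E M, ∀ a : E, (∀ b : E, metricTensor F u.1 u.2 a b = 0) → a = 0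

/-- The equation `i_S d d_J F² = - d F²` on the slashed tangent bundle, written in every induced
chart. -/
def GeodesicEquation (F : TangentBundle 𝓘(ℝ, E) M → ℝ) (S : VField (E := E) M) : Prop :=
  ∀ p : M, ∀ z ∈ chartDomain E p, ∀ η : E × E,
    extDerivOne (dJ (localFun (fun u => F u ^ 2) p)) z (localField S p z) η =
      - fderiv ℝ (localFun (fun u => F u ^ 2) p) z η

/-- `S` is the geodesic spray of `F`. -/
def IsGeodesicSpray (F : TangentBundle 𝓘(ℝ, E) M → ℝ) (S : VField (E := E) M) : Prop :=
  IsSpray S ∧ GeodesicEquation F S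

/-- Finsler metrizability of a spray. -/
def IsFinslerMetrizable (S : VField (E := E) M) : Prop :=
  ∃ F : TangentBundle 𝓘(ℝ, E) M → ℝ, IsFinslerFunction F ∧ GeodesicEquation F S

/-- The projective deformation `S - 2 P ℂ`, where `ℂ` is the Liouville vector field. -/
def projectiveDeformation (S : VField (E := E) M) (P : TangentBundle 𝓘(ℝ, E) M → ℝ) :
    VField (E := E) M :=
  fun u => S u - (2 * P u) • liouville u

/-- `κ` is an eigenvalue at `u` of the Jacobi endomorphism of `S`: there is a nonzero horizontal
vector `X` at `u` with `Φ X = κ J X`. (Tensorial, so it is tested in the chart at the foot of `u`.) -/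
def IsJacobiEigenvalue (S : VField (E := E) M) (u : TangentBundle 𝓘(ℝ, E) M) (κ : ℝ) : Prop :=
  ∃ X : E × E, X ≠ 0 ∧
    horizontalProj (localField S u.1) (tangentChart (E := E) u.1 u) X = X ∧
    jacobiEnd (localField S u.1) (tangentChart (E := E) u.1 u) X = κ • tangentStructure X

end Manifold

end FinslerSpray

end

open scoped Topology

noncomputable section

namespace FinslerSpray

/-! ### Semisprays in coordinates: projectors, Jacobi endomorphism, geodesic equation. -/

section LocalComputations

variable {E : Type*} [NormedAddCommGroup E] [NormedSpace ℝ E]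

/-! Suppose a Finsler function `G` has geodesic spray `S - 2λFℂ`, and put `ρ = log (G / F)`. The
geodesic equations give `S F = 0`, `d_h F = 0`, and the same for `G` with the deformed spray and its
projector `h - λ d_J F ⊗ ℂ - λ F J`. Hence `S ρ = 2λF` and `(hX)ρ = λ(2 (JX)F + F (JX)ρ)`. Commuting
these two identities gives, for horizontal `X`, `(ΦX + λ²F² JX)ρ = 0` (`fderiv_logRatio_jacobiEnd`).

If `-λ²F(u)²` is not an eigenvalue of `Φ` at `u`, then `Φ + λ²F²J` maps horizontal vectors onto
vertical ones at `u`, hence also nearby, so `ρ` is a function of `x` alone there. The horizontal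
identity becomes `∂ρ/∂xⁱ = 2λ ∂F/∂yⁱ`; its left side is independent of `y`, so for `λ ≠ 0` the
vertical Hessian of `F` vanishes at `u`. Then `g = d_yF ⊗ d_yF` has rank at most one, which is
impossible for `n > 1`. Finiteness follows because `Φ` has finitely many eigenvalues at `u`, each
excluding at most two values of `λ`. -/

/-- Product rule for the derivative of a function along a vector field. -/
theorem fderiv_fderiv_apply_add {V : Type*} [NormedAddCommGroup V] [NormedSpace ℝ V]
    {f c : V → ℝ} {X : V → V} {z : V} (hf : ContDiffAt ℝ 2 f z) (hX : DifferentiableAt ℝ X z)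
    (h : ∀ᶠ w in 𝓝 z, fderiv ℝ f w (X w) = c w) (η : V) :
    fderiv ℝ (fderiv ℝ f) z η (X z) + fderiv ℝ f z (fderiv ℝ X z η) = fderiv ℝ c z η := by
  have hf' : DifferentiableAt ℝ (fderiv ℝ f) z :=
    (hf.fderiv_right (m := 1) (by norm_num)).differentiableAt one_ne_zero
  have h1 : (fun w => fderiv ℝ f w (X w)) =ᶠ[𝓝 z] c := h
  rw [← h1.fderiv_eq, (hf'.hasFDerivAt.clm_apply hX.hasFDerivAt).fderiv]
  simp [add_comm]

theorem fderiv_fderiv_comm {V : Type*} [NormedAddCommGroup V] [NormedSpace ℝ V]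
    {f : V → ℝ} {z : V} (hf : ContDiffAt ℝ 2 f z) (ξ η : V) :
    fderiv ℝ (fderiv ℝ f) z ξ η = fderiv ℝ (fderiv ℝ f) z η ξ :=
  (hf.isSymmSndFDerivAt (by simp)) ξ η

@[simp]
theorem tangentStructure_apply (X : E × E) : tangentStructure X = ((0 : E), X.1) := rfl

theorem fderiv_liouville (z η : E × E) :
    fderiv ℝ (localLiouville (E := E)) z η = (0, η.2) := by
  have h : HasFDerivAt (localLiouville (E := E))
      ((ContinuousLinearMap.inr ℝ E E).comp (ContinuousLinearMap.snd ℝ E E)) z :=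
    ((ContinuousLinearMap.inr ℝ E E).comp (ContinuousLinearMap.snd ℝ E E)).hasFDerivAt
  rw [h.fderiv]; rfl

theorem differentiableAt_liouville (z : E × E) :
    DifferentiableAt ℝ (localLiouville (E := E)) z :=
  ((ContinuousLinearMap.inr ℝ E E).comp (ContinuousLinearMap.snd ℝ E E)).differentiableAt

theorem two_le_infty : (2 : ℕ∞ω) ≤ ∞ := by
  exact WithTop.coe_le_coe.2 (le_top : (2 : ℕ∞) ≤ ⊤)

/-- A vector field which is locally a semispray. -/
structure IsSemisprayOn (S : E × E → E × E) (U : Set (E × E)) : Prop where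
  contDiffAt : ∀ z ∈ U, ContDiffAt ℝ ∞ S z
  fst : ∀ z ∈ U, (S z).1 = z.2

variable {S : E × E → E × E} {U : Set (E × E)}

theorem IsSemisprayOn.differentiableAt (hS : IsSemisprayOn S U) {z : E × E} (hz : z ∈ U) :
    DifferentiableAt ℝ S z := (hS.contDiffAt z hz).differentiableAt (by simp)

theorem IsSemisprayOn.fderiv_fst (hS : IsSemisprayOn S U) (hU : IsOpen U) {z : E × E}
    (hz : z ∈ U) (η : E × E) : (fderiv ℝ S z η).1 = η.2 := by
  have h1 : (fun w => (S w).1) =ᶠ[𝓝 z] fun w => w.2 := by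
    filter_upwards [hU.mem_nhds hz] with w hw using hS.fst w hw
  have h2 := h1.fderiv_eq (𝕜 := ℝ)
  rw [((hS.differentiableAt hz).hasFDerivAt.fst).fderiv, fderiv_snd] at h2
  exact congrArg (fun A => A η) h2

theorem IsSemisprayOn.horizontalProj_apply (hS : IsSemisprayOn S U) (hU : IsOpen U) {z : E × E}
    (hz : z ∈ U) (X : E × E) :
    horizontalProj S z X = (X.1, (1 / 2 : ℝ) • (fderiv ℝ S z (0, X.1)).2) := by
  have h1 := hS.fderiv_fst hU hz (0, X.1)
  have h2 := hS.fderiv_fst hU hz X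
  ext
  · simp [horizontalProj, bracketEnd, h1, ← two_smul ℝ, smul_smul]
  · simp [horizontalProj, bracketEnd, h2]

theorem IsSemisprayOn.verticalProj_fst (hS : IsSemisprayOn S U) (hU : IsOpen U) {z : E × E}
    (hz : z ∈ U) (X : E × E) : (verticalProj S z X).1 = 0 := by
  have h1 := hS.fderiv_fst hU hz (0, X.1)
  simp [verticalProj, bracketEnd, h1]

theorem horizontalProj_add_verticalProj (S : E × E → E × E) (z X : E × E) :
    horizontalProj S z X + verticalProj S z X = X := by
  simp only [horizontalProj, verticalProj, smul_apply, sub_apply,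
    add_apply, ContinuousLinearMap.id_apply]
  module

theorem IsSemisprayOn.horizontalProj_vertical (hS : IsSemisprayOn S U) (hU : IsOpen U)
    {z : E × E} (hz : z ∈ U) {X : E × E} (hX : X.1 = 0) : horizontalProj S z X = 0 := by
  have h0 : fderiv ℝ S z ((0 : E), (0 : E)) = 0 := map_zero (fderiv ℝ S z)
  rw [hS.horizontalProj_apply hU hz, hX, h0]
  simp

theorem IsSemisprayOn.jacobiEnd_fst (hS : IsSemisprayOn S U) (hU : IsOpen U) {z : E × E}
    (hz : z ∈ U) (X : E × E) : (jacobiEnd S z X).1 = 0 :=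
  hS.verticalProj_fst hU hz _

theorem IsSemisprayOn.contDiffAt_fderiv (hS : IsSemisprayOn S U) {z : E × E} (hz : z ∈ U) :
    ContDiffAt ℝ ∞ (fderiv ℝ S) z :=
  (hS.contDiffAt z hz).fderiv_right (by simp)

theorem IsSemisprayOn.contDiffAt_bracketEnd (hS : IsSemisprayOn S U)
    {A : E × E → (E × E) →L[ℝ] (E × E)} {z : E × E} (hz : z ∈ U) (hA : ContDiffAt ℝ ∞ A z) :
    ContDiffAt ℝ ∞ (bracketEnd S A) z := by
  have h1 : ContDiffAt ℝ ∞ (fderiv ℝ A) z := hA.fderiv_right (by simp)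
  exact ((h1.clm_apply (hS.contDiffAt z hz)).sub ((hS.contDiffAt_fderiv hz).clm_comp hA)).add
    (hA.clm_comp (hS.contDiffAt_fderiv hz))

theorem IsSemisprayOn.contDiffAt_horizontalProj (hS : IsSemisprayOn S U) {z : E × E}
    (hz : z ∈ U) : ContDiffAt ℝ ∞ (horizontalProj S) z :=
  (contDiffAt_const.sub (hS.contDiffAt_bracketEnd hz contDiffAt_const)).const_smul _

theorem IsSemisprayOn.contDiffAt_verticalProj (hS : IsSemisprayOn S U) {z : E × E}
    (hz : z ∈ U) : ContDiffAt ℝ ∞ (verticalProj S) z :=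
  (contDiffAt_const.add (hS.contDiffAt_bracketEnd hz contDiffAt_const)).const_smul _

theorem IsSemisprayOn.contDiffAt_jacobiEnd (hS : IsSemisprayOn S U) {z : E × E}
    (hz : z ∈ U) : ContDiffAt ℝ ∞ (jacobiEnd S) z :=
  (hS.contDiffAt_verticalProj hz).clm_comp
    (hS.contDiffAt_bracketEnd hz (hS.contDiffAt_horizontalProj hz))

/-- The bracket `[S, h]` maps horizontal vectors to vertical ones. -/
theorem IsSemisprayOn.bracketEnd_horizontalProj_fst (hS : IsSemisprayOn S U) (hU : IsOpen U)
    {z : E × E} (hz : z ∈ U) {X : E × E} (hX : horizontalProj S z X = X) :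
    (bracketEnd S (horizontalProj S) z X).1 = 0 := by
  have hh := (hS.contDiffAt_horizontalProj hz).differentiableAt (by simp)
  -- The `x`-component of `h X` is that of `X` at every base point, so the term `D_S h` contributes
  -- nothing to it.
  have h1 : (fun w => (horizontalProj S w X).1) =ᶠ[𝓝 z] fun _ => X.1 := by
    filter_upwards [hU.mem_nhds hz] with w hw
    rw [hS.horizontalProj_apply hU hw]
  have h2 := congrArg (fun A => A (S z)) (h1.fderiv_eq (𝕜 := ℝ))
  rw [((hh.hasFDerivAt.clm_apply (hasFDerivAt_const X z)).fst).fderiv] at h2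
  simp only [fderiv_fun_const, Pi.zero_apply, zero_apply,
    ContinuousLinearMap.comp_zero, zero_add, ContinuousLinearMap.flip_apply,
    ContinuousLinearMap.coe_fst', ContinuousLinearMap.comp_apply] at h2
  simp only [bracketEnd, add_apply, sub_apply,
    ContinuousLinearMap.comp_apply, hX, Prod.fst_add, Prod.fst_sub, hS.fderiv_fst hU hz,
    hS.horizontalProj_apply hU hz (fderiv ℝ S z X)]
  simpa using h2

theorem IsSemisprayOn.jacobiEnd_of_horizontal (hS : IsSemisprayOn S U) (hU : IsOpen U)
    {z : E × E} (hz : z ∈ U) {X : E × E} (hX : horizontalProj S z X = X) :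
    jacobiEnd S z X = bracketEnd S (horizontalProj S) z X := by
  have h1 := horizontalProj_add_verticalProj S z (bracketEnd S (horizontalProj S) z X)
  rwa [hS.horizontalProj_vertical hU hz (hS.bracketEnd_horizontalProj_fst hU hz hX),
    zero_add] at h1

/-- The Euler-Lagrange equation for a two-homogeneous `L`. -/
theorem fderiv_fderiv_apply_vertical {L : E × E → ℝ} {z : E × E} (hL : ContDiffAt ℝ 2 L z)
    (euler : ∀ᶠ w in 𝓝 z, fderiv ℝ L w (localLiouville w) = 2 * L w) (hfst : (S z).1 = z.2)
    (geod : ∀ η, extDerivOne (dJ L) z (S z) η = - fderiv ℝ L z η) (a : E) :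
    fderiv ℝ (fderiv ℝ L) z (S z) (0, a) = fderiv ℝ L z (a, 0) := by
  have hd : DifferentiableAt ℝ (fderiv ℝ L) z :=
    (hL.fderiv_right (m := 1) (by norm_num)).differentiableAt one_ne_zero
  have hdJ : ∀ ξ η, fderiv ℝ (dJ L) z ξ η = fderiv ℝ (fderiv ℝ L) z ξ (0, η.1) := by
    intro ξ η
    have h : HasFDerivAt (dJ L) _ z :=
      hd.hasFDerivAt.clm_comp (hasFDerivAt_const (tangentStructure (E := E)) z)
    rw [h.fderiv]
    simp
  have h := fderiv_fderiv_apply_add (c := fun w => 2 * L w) hL (differentiableAt_liouville z)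
    euler (a, 0)
  rw [fderiv_liouville, fderiv_const_mul (hL.differentiableAt (by simp))] at h
  -- The only other second-order term here is `D²L((a, 0), ℂ)`, which the differentiated Euler
  -- identity `h` equates to `2 dL(a, 0)`.
  have g := geod (a, 0)
  have e : fderiv ℝ L z ((0 : E), (0 : E)) = 0 := map_zero (fderiv ℝ L z)
  simp only [extDerivOne, hdJ, hfst] at g
  simp only [e, localLiouville, smul_apply, smul_eq_mul] at h
  linarith

/-- The geodesic equation for a two-homogeneous `L` implies `S L = 0`. -/
theorem IsSemisprayOn.fderiv_apply_self (hS : IsSemisprayOn S U)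
    {L : E × E → ℝ} {z : E × E} (hz : z ∈ U) (hL : ContDiffAt ℝ 2 L z)
    (euler : ∀ᶠ w in 𝓝 z, fderiv ℝ L w (localLiouville w) = 2 * L w)
    (geod : ∀ η, extDerivOne (dJ L) z (S z) η = - fderiv ℝ L z η) :
    fderiv ℝ L z (S z) = 0 := by
  have h := fderiv_fderiv_apply_add (c := fun w => 2 * L w) hL (differentiableAt_liouville z)
    euler (S z)
  rw [fderiv_liouville, fderiv_const_mul (hL.differentiableAt (by simp))] at h
  -- Taking `a = y` evaluates `D²L(S, ℂ)`; Euler's identity differentiated along `S` then reads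
  -- `dL(S) = 2 dL(S)`.
  have g := fderiv_fderiv_apply_vertical hL euler (hS.fst z hz) geod z.2
  have split : fderiv ℝ L z (S z) = fderiv ℝ L z (z.2, 0) + fderiv ℝ L z (0, (S z).2) := by
    rw [← map_add]; congr 1; ext <;> simp [hS.fst z hz]
  simp only [localLiouville, smul_apply, smul_eq_mul] at h
  linarith

/-- The geodesic equation for a two-homogeneous `L` implies `d_h L = 0`. -/
theorem IsSemisprayOn.fderiv_horizontalProj (hS : IsSemisprayOn S U) (hU : IsOpen U)
    {L : E × E → ℝ} (hL : ∀ z ∈ U, ContDiffAt ℝ 2 L z)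
    (euler : ∀ z ∈ U, fderiv ℝ L z (localLiouville z) = 2 * L z)
    (geod : ∀ z ∈ U, ∀ η, extDerivOne (dJ L) z (S z) η = - fderiv ℝ L z η)
    {z : E × E} (hz : z ∈ U) (X : E × E) :
    fderiv ℝ L z (horizontalProj S z X) = 0 := by
  have euler' : ∀ w ∈ U, ∀ᶠ w' in 𝓝 w, fderiv ℝ L w' (localLiouville w') = 2 * L w' :=
    fun w hw => by filter_upwards [hU.mem_nhds hw] with w' hw' using euler w' hw'
  -- Differentiating `S L = 0` in the direction `(0, X.1)` produces `dL` of `(X.1, 0) + DS (0,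
  -- X.1)`, which is `2 h X`.
  have h := fderiv_fderiv_apply_add (c := fun _ => 0) (hL z hz) (hS.differentiableAt hz)
    (by filter_upwards [hU.mem_nhds hz] with w hw using
      hS.fderiv_apply_self hw (hL w hw) (euler' w hw) (geod w hw)) (0, X.1)
  rw [fderiv_fderiv_comm (hL z hz), fderiv_fderiv_apply_vertical (hL z hz) (euler' z hz)
    (hS.fst z hz) (geod z hz), ← map_add] at h
  have e : horizontalProj S z X =
      (1 / 2 : ℝ) • (((X.1, 0) : E × E) + fderiv ℝ S z (0, X.1)) := by
    rw [hS.horizontalProj_apply hU hz]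
    ext
    · simp [hS.fderiv_fst hU hz, ← two_smul ℝ, smul_smul]
    · simp
  rw [e, map_smul, h]
  simp

/-! ### One-homogeneous functions and projective deformations. -/

/-- A positive smooth function which is one-homogeneous in the fibre variable. -/
structure IsHomogeneousOn (f : E × E → ℝ) (U : Set (E × E)) : Prop where
  contDiffAt : ∀ z ∈ U, ContDiffAt ℝ ∞ f z
  pos : ∀ z ∈ U, 0 < f z
  euler : ∀ z ∈ U, fderiv ℝ f z (localLiouville z) = f z

variable {f g : E × E → ℝ}

theorem IsHomogeneousOn.differentiableAt (hf : IsHomogeneousOn f U) {z : E × E} (hz : z ∈ U) :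
    DifferentiableAt ℝ f z := (hf.contDiffAt z hz).differentiableAt (by simp)

theorem IsHomogeneousOn.fderiv_sq (hf : IsHomogeneousOn f U) {z : E × E} (hz : z ∈ U)
    (X : E × E) : fderiv ℝ (fun w => f w ^ 2) z X = 2 * f z * fderiv ℝ f z X := by
  rw [fderiv_fun_pow 2 (hf.differentiableAt hz)]
  simp

theorem IsHomogeneousOn.euler_sq (hf : IsHomogeneousOn f U) {z : E × E} (hz : z ∈ U) :
    fderiv ℝ (fun w => f w ^ 2) z (localLiouville z) = 2 * f z ^ 2 := by
  rw [hf.fderiv_sq hz, hf.euler z hz]; ring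

theorem IsHomogeneousOn.fderiv_spray (hf : IsHomogeneousOn f U) (hS : IsSemisprayOn S U)
    (hU : IsOpen U)
    (geod : ∀ z ∈ U, ∀ η, extDerivOne (dJ fun w => f w ^ 2) z (S z) η =
      - fderiv ℝ (fun w => f w ^ 2) z η)
    {z : E × E} (hz : z ∈ U) : fderiv ℝ f z (S z) = 0 := by
  have h := hS.fderiv_apply_self hz (((hf.contDiffAt z hz).of_le two_le_infty).pow 2)
    (by filter_upwards [hU.mem_nhds hz] with w hw using hf.euler_sq hw) (geod z hz)
  rw [hf.fderiv_sq hz] at h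
  simpa [(hf.pos z hz).ne'] using h

theorem IsHomogeneousOn.fderiv_horizontal (hf : IsHomogeneousOn f U) (hS : IsSemisprayOn S U)
    (hU : IsOpen U)
    (geod : ∀ z ∈ U, ∀ η, extDerivOne (dJ fun w => f w ^ 2) z (S z) η =
      - fderiv ℝ (fun w => f w ^ 2) z η)
    {z : E × E} (hz : z ∈ U) (X : E × E) : fderiv ℝ f z (horizontalProj S z X) = 0 := by
  have h := hS.fderiv_horizontalProj hU
    (fun w hw => ((hf.contDiffAt w hw).of_le two_le_infty).pow 2)
    (fun w hw => hf.euler_sq hw) geod hz X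
  rw [hf.fderiv_sq hz] at h
  simpa [(hf.pos z hz).ne'] using h

theorem contDiff_liouville : ContDiff ℝ ∞ (localLiouville (E := E)) :=
  ((ContinuousLinearMap.inr ℝ E E).comp (ContinuousLinearMap.snd ℝ E E)).contDiff

variable {S' : E × E → E × E} {lam : ℝ}

theorem IsSemisprayOn.deformation (hS : IsSemisprayOn S U) (hU : IsOpen U)
    (hf : IsHomogeneousOn f U)
    (hS' : ∀ z ∈ U, S' z = S z - (2 * (lam * f z)) • localLiouville z) :
    IsSemisprayOn S' U where
  contDiffAt z hz := by
    have h : ContDiffAt ℝ ∞ (fun w => S w - (2 * (lam * f w)) • localLiouville w) z :=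
      (hS.contDiffAt z hz).sub ((contDiffAt_const.mul (contDiffAt_const.mul
        (hf.contDiffAt z hz))).smul contDiff_liouville.contDiffAt)
    exact h.congr_of_eventuallyEq (by filter_upwards [hU.mem_nhds hz] with w hw using hS' w hw)
  fst z hz := by rw [hS' z hz]; simp [localLiouville, hS.fst z hz]

/-- The horizontal projector of a projective deformation. -/
theorem IsSemisprayOn.horizontalProj_deformation (hS : IsSemisprayOn S U) (hU : IsOpen U)
    (hf : IsHomogeneousOn f U)
    (hS' : ∀ z ∈ U, S' z = S z - (2 * (lam * f z)) • localLiouville z)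
    {z : E × E} (hz : z ∈ U) (X : E × E) :
    horizontalProj S' z X = horizontalProj S z X
      - (lam * fderiv ℝ f z (tangentStructure X)) • localLiouville z
      - (lam * f z) • tangentStructure X := by
  have e : S' =ᶠ[𝓝 z] fun w => S w - (2 * (lam * f w)) • localLiouville w := by
    filter_upwards [hU.mem_nhds hz] with w hw using hS' w hw
  have hd : HasFDerivAt (fun w => S w - (2 * (lam * f w)) • localLiouville w) _ z :=
    (hS.differentiableAt hz).hasFDerivAt.sub
      ((((hf.differentiableAt hz).hasFDerivAt.const_mul lam).const_mul 2).smul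
        (differentiableAt_liouville z).hasFDerivAt)
  rw [(hS.deformation hU hf hS').horizontalProj_apply hU hz, hS.horizontalProj_apply hU hz,
    e.fderiv_eq, hd.fderiv]
  ext
  · simp [localLiouville]
  · simp only [sub_apply, add_apply, smul_apply, fderiv_liouville, tangentStructure_apply,
      localLiouville, Prod.snd_sub, Prod.snd_add, Prod.smul_snd, ContinuousLinearMap.smulRight_apply,
      smul_eq_mul]
    module

end LocalComputations

/-! ### The logarithmic ratio of the two Finsler functions. -/

section LogRatio

variable {E : Type*} [NormedAddCommGroup E] [NormedSpace ℝ E]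
  {S S' : E × E → E × E} {U : Set (E × E)} {f g : E × E → ℝ} {lam : ℝ}

/-- The logarithm of the ratio of two functions. -/
def logRatio (g f : E × E → ℝ) (z : E × E) : ℝ := Real.log (g z) - Real.log (f z)

theorem IsHomogeneousOn.contDiffAt_logRatio (hg : IsHomogeneousOn g U) (hf : IsHomogeneousOn f U)
    {z : E × E} (hz : z ∈ U) : ContDiffAt ℝ ∞ (logRatio g f) z :=
  ((hg.contDiffAt z hz).log (hg.pos z hz).ne').sub ((hf.contDiffAt z hz).log (hf.pos z hz).ne')

theorem IsHomogeneousOn.fderiv_logRatio (hg : IsHomogeneousOn g U) (hf : IsHomogeneousOn f U)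
    {z : E × E} (hz : z ∈ U) (X : E × E) :
    fderiv ℝ (logRatio g f) z X = fderiv ℝ g z X / g z - fderiv ℝ f z X / f z := by
  have h : HasFDerivAt (logRatio g f) _ z :=
    ((hg.differentiableAt hz).hasFDerivAt.log (hg.pos z hz).ne').sub
      ((hf.differentiableAt hz).hasFDerivAt.log (hf.pos z hz).ne')
  rw [h.fderiv]
  simp only [sub_apply, smul_apply, smul_eq_mul]
  ring

/-- A one-homogeneous function `f` is horizontally constant for the spray `S`, and so is another
one, `g`, for the deformation `S - 2 lam f ℂ`. -/
structure IsDeformationPair (S S' : E × E → E × E) (U : Set (E × E)) (f g : E × E → ℝ)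
    (lam : ℝ) : Prop where
  isOpen : IsOpen U
  spray : IsSemisprayOn S U
  left : IsHomogeneousOn f U
  right : IsHomogeneousOn g U
  eq : ∀ z ∈ U, S' z = S z - (2 * (lam * f z)) • localLiouville z
  geodesic_left : ∀ z ∈ U, ∀ η, extDerivOne (dJ fun w => f w ^ 2) z (S z) η =
      - fderiv ℝ (fun w => f w ^ 2) z η
  geodesic_right : ∀ z ∈ U, ∀ η, extDerivOne (dJ fun w => g w ^ 2) z (S' z) η =
      - fderiv ℝ (fun w => g w ^ 2) z η

namespace IsDeformationPair

variable (H : IsDeformationPair S S' U f g lam)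
include H

theorem spray' : IsSemisprayOn S' U := H.spray.deformation H.isOpen H.left H.eq

/-- Since `S' g = 0` and `ℂ g = g`, one has `S g = 2 lam f g`, while `S f = 0`. -/
theorem fderiv_logRatio_spray {z : E × E} (hz : z ∈ U) :
    fderiv ℝ (logRatio g f) z (S z) = 2 * lam * f z := by
  have h1 := H.right.fderiv_spray H.spray' H.isOpen H.geodesic_right hz
  have h2 := H.left.fderiv_spray H.spray H.isOpen H.geodesic_left hz
  have hg := H.right.pos z hz
  rw [H.eq z hz, map_sub, map_smul, H.right.euler z hz, smul_eq_mul] at h1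
  rw [H.right.fderiv_logRatio H.left hz, h2, sub_eq_zero.1 h1]
  have hf := H.left.pos z hz
  field_simp
  simp

/-- Expand `(h' X) g = 0` with the formula for the deformed projector `h'`, divide by `g`, and use
`(h X) f = 0`. -/
theorem fderiv_logRatio_horizontal {z : E × E} (hz : z ∈ U) (X : E × E) :
    fderiv ℝ (logRatio g f) z (horizontalProj S z X) =
      lam * (2 * fderiv ℝ f z (tangentStructure X)
        + f z * fderiv ℝ (logRatio g f) z (tangentStructure X)) := by
  have h1 := H.right.fderiv_horizontal H.spray' H.isOpen H.geodesic_right hz X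
  have h2 := H.left.fderiv_horizontal H.spray H.isOpen H.geodesic_left hz X
  have hg := H.right.pos z hz
  have hf := H.left.pos z hz
  rw [H.spray.horizontalProj_deformation H.isOpen H.left H.eq hz, map_sub, map_sub, map_smul,
    map_smul, H.right.euler z hz, smul_eq_mul, smul_eq_mul, sub_sub, sub_eq_zero] at h1
  rw [H.right.fderiv_logRatio H.left hz, H.right.fderiv_logRatio H.left hz, h2, h1]
  field_simp
  ring

/-- This is the commutator of the two first-order identities for `ρ`. The last term comes from `JX`
acting on `S ρ = 2 lam f`. -/
theorem fderiv_logRatio_bracketEnd {z : E × E} (hz : z ∈ U) (X : E × E) :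
    fderiv ℝ (logRatio g f) z (bracketEnd S (horizontalProj S) z X) =
      lam * (2 * fderiv ℝ f z (bracketEnd S (fun _ => tangentStructure) z X)
        + f z * fderiv ℝ (logRatio g f) z (bracketEnd S (fun _ => tangentStructure) z X)
        + 2 * lam * f z * fderiv ℝ f z (tangentStructure X)) := by
  have hnear := H.isOpen.mem_nhds hz
  have hρ2 := (H.right.contDiffAt_logRatio H.left hz).of_le two_le_infty
  have hf2 := (H.left.contDiffAt z hz).of_le two_le_infty
  have hfd := H.left.differentiableAt hz
  have hρ' : DifferentiableAt ℝ (fderiv ℝ (logRatio g f)) z :=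
    (hρ2.fderiv_right (m := 1) (by norm_num)).differentiableAt one_ne_zero
  have hf' : DifferentiableAt ℝ (fderiv ℝ f) z :=
    (hf2.fderiv_right (m := 1) (by norm_num)).differentiableAt one_ne_zero
  have hSd := H.spray.differentiableAt hz
  have hh : DifferentiableAt ℝ (horizontalProj S) z :=
    (H.spray.contDiffAt_horizontalProj hz).differentiableAt (by simp)
  have hhX := hh.hasFDerivAt.clm_apply (hasFDerivAt_const X z)
  have e1 := fderiv_fderiv_apply_add hρ2 hhX.differentiableAt
    (by filter_upwards [hnear] with w hw using H.fderiv_logRatio_horizontal hw X) (S z)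
  have hc : HasFDerivAt (fun w => lam * (2 * fderiv ℝ f w (tangentStructure X)
        + f w * fderiv ℝ (logRatio g f) w (tangentStructure X))) _ z :=
    (((hf'.hasFDerivAt.clm_apply (hasFDerivAt_const (tangentStructure X) z)).const_mul 2).add
      (hfd.hasFDerivAt.mul
        (hρ'.hasFDerivAt.clm_apply (hasFDerivAt_const (tangentStructure X) z)))).const_mul lam
  have e2 : ∀ η, _ := fderiv_fderiv_apply_add hρ2 hSd
    (by filter_upwards [hnear] with w hw using H.fderiv_logRatio_spray hw)
  have e3 : ∀ η, _ := fderiv_fderiv_apply_add (c := fun _ => 0) hf2 hSd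
    (by filter_upwards [hnear] with w hw using
      H.left.fderiv_spray H.spray H.isOpen H.geodesic_left hw)
  have e4 := H.fderiv_logRatio_horizontal hz (fderiv ℝ S z X)
  have e5 := H.left.fderiv_spray H.spray H.isOpen H.geodesic_left hz
  have e9 := H.left.fderiv_horizontal H.spray H.isOpen H.geodesic_left hz X
  rw [hc.fderiv, hhX.fderiv, fderiv_fderiv_comm hρ2] at e1
  simp only [fderiv_const_mul hfd, fderiv_fun_const] at e2 e3
  have e6 := e2 (horizontalProj S z X)
  have e7 := e2 (tangentStructure X)
  have e8 := e3 (tangentStructure X)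
  rw [fderiv_fderiv_comm hρ2] at e7
  rw [fderiv_fderiv_comm hf2] at e8
  simp only [add_apply, smul_apply, smul_eq_mul, ContinuousLinearMap.comp_apply, zero_apply,
    ContinuousLinearMap.flip_apply, map_zero, zero_add, e5, e9, mul_zero, add_zero,
    Pi.zero_apply] at e1 e6 e7 e8
  simp only [bracketEnd, add_apply, sub_apply, map_add, map_sub, ContinuousLinearMap.comp_apply,
    fderiv_fun_const, Pi.zero_apply, zero_apply, zero_sub, neg_apply, map_neg]
  -- For constant `X`, `[S, h]X` acts as `S(hX ·) - hX(S ·) + h(DS X)`: these are `e1`, `e6`, `e4`.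
  -- Moving `S` past `JX` by `e7` and `e8` supplies the part `-DS(JX)` of `[S, J]X`; the part `J(DS
  -- X)` comes from `e4`.
  linear_combination e1 - e6 + e4 + lam * 2 * e8 + lam * f z * e7

theorem fderiv_logRatio_jacobiEnd {z : E × E} (hz : z ∈ U) {X : E × E}
    (hX : horizontalProj S z X = X) :
    fderiv ℝ (logRatio g f) z
      (jacobiEnd S z X + (lam ^ 2 * f z ^ 2) • tangentStructure X) = 0 := by
  -- Since `2h = Id - [S, J]`, being horizontal means `[S, J]X = -X`.
  have hJ : bracketEnd S (fun _ => tangentStructure) z X = -X := by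
    have h := hX
    simp only [horizontalProj, smul_apply, sub_apply, ContinuousLinearMap.id_apply] at h
    have h2 := congrArg (fun Y => (2 : ℝ) • Y) h
    simp only [smul_smul] at h2
    norm_num at h2
    rw [two_smul, sub_eq_iff_eq_add] at h2
    have h3 : X = X + (X + bracketEnd S (fun _ => tangentStructure) z X) := by
      rw [← add_assoc]; exact h2
    exact (neg_eq_of_add_eq_zero_right (left_eq_add.1 h3)).symm
  have h1 := H.fderiv_logRatio_bracketEnd hz X
  have h2 := H.left.fderiv_horizontal H.spray H.isOpen H.geodesic_left hz X
  have h3 := H.fderiv_logRatio_horizontal hz X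
  rw [hX] at h2 h3
  rw [hJ, map_neg, map_neg, h2, h3] at h1
  rw [map_add, H.spray.jacobiEnd_of_horizontal H.isOpen hz hX, h1, map_smul, smul_eq_mul]
  ring

end IsDeformationPair

/-! ### Eigenvalues of the Jacobi endomorphism and degeneracy of the metric. -/

/-- The Jacobi endomorphism of a semispray, as an endomorphism `a ↦ b` of `E`, where
`Φ (h (a, 0)) = (0, b)`. -/
def jacobiBase (S : E × E → E × E) (z : E × E) : E →L[ℝ] E :=
  (ContinuousLinearMap.snd ℝ E E).comp
    (((jacobiEnd S z).comp (horizontalProj S z)).comp (ContinuousLinearMap.inl ℝ E E))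

theorem IsSemisprayOn.continuousAt_jacobiBase (hS : IsSemisprayOn S U) {z : E × E} (hz : z ∈ U) :
    ContinuousAt (jacobiBase S) z :=
  (contDiffAt_const.clm_comp (((hS.contDiffAt_jacobiEnd hz).clm_comp
    (hS.contDiffAt_horizontalProj hz)).clm_comp contDiffAt_const)).continuousAt (n := ∞)

theorem IsSemisprayOn.horizontalProj_idem (hS : IsSemisprayOn S U) (hU : IsOpen U) {z : E × E}
    (hz : z ∈ U) (X : E × E) :
    horizontalProj S z (horizontalProj S z X) = horizontalProj S z X := by
  rw [hS.horizontalProj_apply hU hz X, hS.horizontalProj_apply hU hz]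

theorem IsSemisprayOn.horizontalProj_inl (hS : IsSemisprayOn S U) (hU : IsOpen U) {z : E × E}
    (hz : z ∈ U) (X : E × E) : horizontalProj S z (X.1, 0) = horizontalProj S z X := by
  rw [hS.horizontalProj_apply hU hz X, hS.horizontalProj_apply hU hz]

theorem IsSemisprayOn.jacobiEnd_horizontalProj (hS : IsSemisprayOn S U) (hU : IsOpen U)
    {z : E × E} (hz : z ∈ U) (a : E) :
    jacobiEnd S z (horizontalProj S z (a, 0)) = (0, jacobiBase S z a) := by
  ext
  · exact hS.jacobiEnd_fst hU hz _
  · rfl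

theorem IsSemisprayOn.finite_jacobi_eigenvalues [FiniteDimensional ℝ E] (hS : IsSemisprayOn S U)
    (hU : IsOpen U) {z : E × E} (hz : z ∈ U) :
    {κ : ℝ | ∃ X : E × E, X ≠ 0 ∧ horizontalProj S z X = X ∧
      jacobiEnd S z X = κ • tangentStructure X}.Finite := by
  refine (Module.End.finite_hasEigenvalue (jacobiBase S z : E →ₗ[ℝ] E)).subset ?_
  rintro κ ⟨X, hX0, hX, hκ⟩
  have hX' : horizontalProj S z (X.1, 0) = X := by rw [hS.horizontalProj_inl hU hz, hX]
  refine Module.End.hasEigenvalue_of_hasEigenvector (x := X.1)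
    ⟨Module.End.mem_eigenspace_iff.2 ?_, fun h => hX0 ?_⟩
  · have h := hS.jacobiEnd_horizontalProj hU hz X.1
    rw [hX', hκ] at h
    exact (congrArg Prod.snd h).symm
  · rw [← hX, hS.horizontalProj_vertical hU hz h]

/-- The horizontal lift of a nonzero kernel vector would be an eigenvector of `Φ` for `-c`; in
finite dimension injectivity suffices. -/
theorem IsSemisprayOn.isUnit_jacobiBase_add [FiniteDimensional ℝ E] (hS : IsSemisprayOn S U)
    (hU : IsOpen U) {z : E × E} (hz : z ∈ U) {c : ℝ}
    (h : ∀ X : E × E, X ≠ 0 → horizontalProj S z X = X →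
      jacobiEnd S z X ≠ (-c) • tangentStructure X) :
    IsUnit (jacobiBase S z + c • (1 : E →L[ℝ] E)) := by
  have hinj : Function.Injective (jacobiBase S z + c • (1 : E →L[ℝ] E)) := by
    refine (injective_iff_map_eq_zero _).2 fun a ha => ?_
    by_contra ha0
    refine h (horizontalProj S z (a, 0)) ?_ (hS.horizontalProj_idem hU hz _) ?_
    · rw [hS.horizontalProj_apply hU hz]
      exact fun h0 => ha0 (congrArg Prod.fst h0)
    · rw [hS.jacobiEnd_horizontalProj hU hz, tangentStructure_apply,
        hS.horizontalProj_apply hU hz]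
      have ha' : jacobiBase S z a + c • a = 0 := ha
      rw [eq_neg_of_add_eq_zero_left ha']
      simp
  exact ContinuousLinearMap.isUnit_iff_bijective.2
    ⟨hinj, (LinearMap.injective_iff_surjective
      (f := ((jacobiBase S z + c • (1 : E →L[ℝ] E) : E →L[ℝ] E) : E →ₗ[ℝ] E))).1 hinj⟩

namespace IsDeformationPair

variable (H : IsDeformationPair S S' U f g lam)
include H

theorem eventually_fderiv_logRatio_vertical [FiniteDimensional ℝ E] {z : E × E} (hz : z ∈ U)
    (h : ∀ X : E × E, X ≠ 0 → horizontalProj S z X = X →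
      jacobiEnd S z X ≠ (-(lam ^ 2 * f z ^ 2)) • tangentStructure X) :
    ∀ᶠ w in 𝓝 z, ∀ b, fderiv ℝ (logRatio g f) w (0, b) = 0 := by
  have hunit := H.spray.isUnit_jacobiBase_add H.isOpen hz h
  have hcont : ContinuousAt
      (fun w => jacobiBase S w + (lam ^ 2 * f w ^ 2) • (1 : E →L[ℝ] E)) z :=
    (H.spray.continuousAt_jacobiBase hz).add ((continuousAt_const.mul
      ((H.left.contDiffAt z hz).continuousAt.pow 2)).smul continuousAt_const)
  have : CompleteSpace E := FiniteDimensional.complete ℝ E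
  -- Invertibility is an open condition, so the vanishing holds on a neighbourhood and can be
  -- differentiated again.
  filter_upwards [hcont.eventually (Units.isOpen.mem_nhds hunit), H.isOpen.mem_nhds hz]
    with w hw hwU b
  obtain ⟨a, rfl⟩ := (ContinuousLinearMap.isUnit_iff_bijective.1 hw).2 b
  have h1 := H.fderiv_logRatio_jacobiEnd hwU (H.spray.horizontalProj_idem H.isOpen hwU (a, 0))
  rw [H.spray.jacobiEnd_horizontalProj H.isOpen hwU, tangentStructure_apply,
    H.spray.horizontalProj_apply H.isOpen hwU] at h1
  rw [← h1]
  congr 1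
  ext <;> simp

theorem fderiv_fderiv_vertical_eq_zero [FiniteDimensional ℝ E] (hlam : lam ≠ 0) {z : E × E}
    (hz : z ∈ U) (h : ∀ X : E × E, X ≠ 0 → horizontalProj S z X = X →
      jacobiEnd S z X ≠ (-(lam ^ 2 * f z ^ 2)) • tangentStructure X) (a b : E) :
    fderiv ℝ (fderiv ℝ f) z (0, a) (0, b) = 0 := by
  have hρ2 := (H.right.contDiffAt_logRatio H.left hz).of_le two_le_infty
  have hf2 := (H.left.contDiffAt z hz).of_le two_le_infty
  have hf' : DifferentiableAt ℝ (fderiv ℝ f) z :=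
    (hf2.fderiv_right (m := 1) (by norm_num)).differentiableAt one_ne_zero
  have hv := H.eventually_fderiv_logRatio_vertical hz h
  -- With no fibre dependence in `ρ`, the vertical part of the horizontal lift drops out: `∂ρ/∂x = 2
  -- lam ∂f/∂y`.
  have h1 : ∀ᶠ w in 𝓝 z, fderiv ℝ (logRatio g f) w (b, 0) = 2 * lam * fderiv ℝ f w (0, b) := by
    filter_upwards [hv, H.isOpen.mem_nhds hz] with w hw hwU
    have e := H.fderiv_logRatio_horizontal hwU (b, 0)
    have e' : horizontalProj S w (b, 0) = (b, 0) + (0, (horizontalProj S w (b, 0)).2) := by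
      ext <;> simp [H.spray.horizontalProj_apply H.isOpen hwU]
    rw [e', map_add, hw, tangentStructure_apply, hw] at e
    simp only at e
    linarith
  have h2 := fderiv_fderiv_apply_add hρ2 (differentiableAt_const (((b, 0) : E × E))) h1 (0, a)
  -- The mixed derivative of `ρ` vanishes, and by symmetry it equals `2 lam` times the vertical
  -- Hessian of `f`.
  have h3 := fderiv_fderiv_apply_add (c := fun _ => 0) hρ2
    (differentiableAt_const (((0, a) : E × E))) (by filter_upwards [hv] with w hw using hw a) (b, 0)
  have h4 := fderiv_fderiv_apply_add (c := fun w => fderiv ℝ f w (0, b)) hf2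
    (differentiableAt_const (((0, b) : E × E))) (by simp) (0, a)
  have hc : DifferentiableAt ℝ (fun w => fderiv ℝ f w ((0, b) : E × E)) z :=
    hf'.clm_apply (differentiableAt_const _)
  rw [fderiv_const_mul hc, fderiv_fderiv_comm hρ2] at h2
  simp only [fderiv_fun_const, Pi.zero_apply, zero_apply, map_zero, add_zero, smul_apply,
    smul_eq_mul] at h2 h3 h4
  rw [h3, ← h4] at h2
  simpa [hlam] using h2.symm

/-- The vertical Hessian of `f ^ 2` is degenerate. -/
theorem exists_fderiv_fderiv_sq_eq_zero [FiniteDimensional ℝ E] (hn : 1 < Module.finrank ℝ E)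
    (hlam : lam ≠ 0) {z : E × E}
    (hz : z ∈ U) (h : ∀ X : E × E, X ≠ 0 → horizontalProj S z X = X →
      jacobiEnd S z X ≠ (-(lam ^ 2 * f z ^ 2)) • tangentStructure X) :
    ∃ a : E, a ≠ 0 ∧ ∀ b : E,
      fderiv ℝ (fderiv ℝ fun w => f w ^ 2) z (0, a) (0, b) = 0 := by
  -- With the Hessian of `f` gone, that of `f ^ 2` is `2 df ⊗ df`; as `n > 1`, its kernel contains a
  -- nonzero `a`.
  obtain ⟨a, ha, ha0⟩ : ∃ a ∈ LinearMap.ker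
      (((fderiv ℝ f z).comp (ContinuousLinearMap.inr ℝ E E) : E →L[ℝ] ℝ) : E →ₗ[ℝ] ℝ), a ≠ 0 :=
    Submodule.exists_mem_ne_zero_of_ne_bot
      (LinearMap.ker_ne_bot_of_finrank_lt (by simpa using hn))
  have ha' : fderiv ℝ f z (0, a) = 0 := ha
  refine ⟨a, ha0, fun b => ?_⟩
  have hf2 := (H.left.contDiffAt z hz).of_le two_le_infty
  have hf' : DifferentiableAt ℝ (fderiv ℝ f) z :=
    (hf2.fderiv_right (m := 1) (by norm_num)).differentiableAt one_ne_zero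
  have h1 := fderiv_fderiv_apply_add (hf2.pow 2) (differentiableAt_const (((0, b) : E × E)))
    (by filter_upwards [H.isOpen.mem_nhds hz] with w hw using H.left.fderiv_sq hw (0, b)) (0, a)
  have hc : HasFDerivAt (fun w => 2 * f w * fderiv ℝ f w ((0, b) : E × E)) _ z :=
    ((H.left.differentiableAt hz).hasFDerivAt.const_mul 2).mul
      (hf'.hasFDerivAt.clm_apply (hasFDerivAt_const _ z))
  rw [hc.fderiv] at h1
  simpa [ha', H.fderiv_fderiv_vertical_eq_zero hlam hz h] using h1

end IsDeformationPair

end LogRatio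

/-! ### Transfer between the manifold and induced charts. -/

section InducedCharts

variable {E : Type*} [NormedAddCommGroup E] [NormedSpace ℝ E]
  {M : Type*} [TopologicalSpace M] [ChartedSpace E M] [IsManifold 𝓘(ℝ, E) ∞ M]

theorem tangentChart_apply (p : M) (u : TangentBundle 𝓘(ℝ, E) M) :
    tangentChart (E := E) p u =
      (extChartAt 𝓘(ℝ, E) p u.1, tangentCoordChange 𝓘(ℝ, E) u.1 p u.1 u.2) := rfl

theorem tangentChart_symm_apply (p : M) (z : E × E) :
    (tangentChart (E := E) p).symm z =
      ⟨(extChartAt 𝓘(ℝ, E) p).symm z.1, tangentCoordChange 𝓘(ℝ, E) p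
        ((extChartAt 𝓘(ℝ, E) p).symm z.1) ((extChartAt 𝓘(ℝ, E) p).symm z.1) z.2⟩ := rfl

theorem isOpen_tangentChart_target (p : M) : IsOpen (tangentChart (E := E) p).target :=
  isOpen_extChartAt_target _

theorem isOpen_chartDomain (p : M) : IsOpen (chartDomain E p) :=
  (isOpen_tangentChart_target p).inter (isOpen_ne_fun continuous_snd continuous_const)

theorem tangentChart_symm_smul (p : M) (z : E × E) (c : ℝ) :
    (tangentChart (E := E) p).symm (z.1, c • z.2) =
      ⟨((tangentChart (E := E) p).symm z).1, c • ((tangentChart (E := E) p).symm z).2⟩ := by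
  rw [tangentChart_symm_apply, tangentChart_symm_apply, map_smul]
  rfl

theorem tangentChart_symm_mem_slashed {p : M} {z : E × E} (hz : z ∈ chartDomain E p) :
    (tangentChart (E := E) p).symm z ∈ slashed E M := by
  intro h0
  have h := (tangentChart (E := E) p).right_inv hz.1
  rw [tangentChart_apply, h0] at h
  apply hz.2
  rw [← congrArg Prod.snd h]
  exact map_zero _

theorem tangentChart_mk_self (p : M) (w : E) :
    tangentChart (E := E) p (⟨p, w⟩ : TangentBundle 𝓘(ℝ, E) M) = (extChartAt 𝓘(ℝ, E) p p, w) := by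
  rw [tangentChart_apply]
  exact congrArg _ (tangentCoordChange_self (mem_extChartAt_source p))

theorem mk_mem_tangentChart_source (p : M) (w : E) :
    (⟨p, w⟩ : TangentBundle 𝓘(ℝ, E) M) ∈ (tangentChart (E := E) p).source := by
  rw [tangentChart, extChartAt_source, TangentBundle.mem_chart_source_iff]
  exact mem_chart_source E p

theorem tangentChart_symm_self (p : M) (w : E) :
    (tangentChart (E := E) p).symm (extChartAt 𝓘(ℝ, E) p p, w) = ⟨p, w⟩ := by
  rw [← tangentChart_mk_self]
  exact (tangentChart (E := E) p).left_inv (mk_mem_tangentChart_source p w)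

theorem tangentChart_mem_chartDomain {u : TangentBundle 𝓘(ℝ, E) M} (hu : u ∈ slashed E M) :
    tangentChart (E := E) u.1 u ∈ chartDomain E u.1 := by
  obtain ⟨p, y⟩ := u
  refine ⟨(tangentChart (E := E) p).map_source (mk_mem_tangentChart_source (E := E) p y), ?_⟩
  have h := congrArg Prod.snd (tangentChart_mk_self (E := E) p y)
  intro h0
  exact hu (h.symm.trans h0)

theorem localFun_isHomogeneousOn {F : TangentBundle 𝓘(ℝ, E) M → ℝ} (hF : IsFinslerFunction F)
    (p : M) : IsHomogeneousOn (localFun F p) (chartDomain E p) := by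
  have hsm : ∀ z ∈ chartDomain E p, ContDiffAt ℝ ∞ (localFun F p) z := by
    have h1 : ContMDiffOn 𝓘(ℝ, E × E) 𝓘(ℝ, ℝ) ∞ (localFun F p) (chartDomain E p) :=
      hF.smooth.comp ((contMDiffOn_extChartAt_symm _).mono fun z hz => hz.1)
        fun _ hz => tangentChart_symm_mem_slashed hz
    intro z hz
    exact (contMDiffOn_iff_contDiffOn.1 h1).contDiffAt ((isOpen_chartDomain p).mem_nhds hz)
  refine ⟨hsm, fun z hz => hF.pos _ (tangentChart_symm_mem_slashed hz), fun z hz => ?_⟩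
  have hd : DifferentiableAt ℝ (localFun F p) z := (hsm z hz).differentiableAt (by simp)
  -- Euler's identity: differentiate homogeneity along the ray `c ↦ (x, c y)` at `c = 1`.
  have hc : HasDerivAt (fun c : ℝ => ((z.1, c • z.2) : E × E)) (localLiouville z) 1 := by
    have h := (hasDerivAt_const (1 : ℝ) z.1).prodMk ((hasDerivAt_id (1 : ℝ)).smul_const z.2)
    simpa [localLiouville] using h
  have h1 : HasDerivAt (fun c : ℝ => localFun F p (z.1, c • z.2))
      (fderiv ℝ (localFun F p) z (localLiouville z)) 1 := by
    have hd' : HasFDerivAt (localFun F p) (fderiv ℝ (localFun F p) z)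
        ((fun c : ℝ => ((z.1, c • z.2) : E × E)) 1) := by simpa using hd.hasFDerivAt
    exact hd'.comp_hasDerivAt 1 hc
  have h2 : HasDerivAt (fun c : ℝ => localFun F p (z.1, c • z.2)) (localFun F p z) 1 := by
    have h := (hasDerivAt_id (1 : ℝ)).mul_const (localFun F p z)
    rw [one_mul] at h
    refine h.congr_of_eventuallyEq ?_
    filter_upwards [lt_mem_nhds one_pos] with c hc
    have e := hF.homogeneous c hc ((tangentChart (E := E) p).symm z)
    rw [localFun, tangentChart_symm_smul]
    exact e
  exact h1.unique h2

theorem mfderiv_tangentChart_liouville (p x : M) (y : E)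
    (h : (⟨x, y⟩ : TangentBundle 𝓘(ℝ, E) M) ∈ (tangentChart (E := E) p).source) :
    mfderiv (𝓘(ℝ, E).tangent) 𝓘(ℝ, E × E) (tangentChart (E := E) p)
      (⟨x, y⟩ : TangentBundle 𝓘(ℝ, E) M) (liouville (⟨x, y⟩ : TangentBundle 𝓘(ℝ, E) M)) =
      localLiouville (tangentChart (E := E) p (⟨x, y⟩ : TangentBundle 𝓘(ℝ, E) M)) := by
  have hchart : MDifferentiableAt (𝓘(ℝ, E).tangent) 𝓘(ℝ, E × E) (tangentChart (E := E) p)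
      (⟨x, y⟩ : TangentBundle 𝓘(ℝ, E) M) := by
    refine mdifferentiableAt_extChartAt ?_
    rwa [tangentChart, extChartAt_source] at h
  have hι : MDifferentiableAt 𝓘(ℝ, E) (𝓘(ℝ, E).tangent)
      (fun w : E => (⟨x, w⟩ : TangentBundle 𝓘(ℝ, E) M)) y := by
    refine ContMDiffAt.mdifferentiableAt (n := 1) ?_ one_ne_zero
    refine Bundle.contMDiffAt_totalSpace.2 ⟨contMDiffAt_const, ?_⟩
    exact (tangentCoordChange 𝓘(ℝ, E) x x x).contDiff.contDiffAt.contMDiffAt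
  -- The chart is linear on fibres, so the derivative of the fibre inclusion sends `y` to its own
  -- fibre coordinate.
  have hder : HasFDerivAt
      (fun w : E => (extChartAt 𝓘(ℝ, E) p x, tangentCoordChange 𝓘(ℝ, E) x p x w))
      (ContinuousLinearMap.prod (0 : E →L[ℝ] E) (tangentCoordChange 𝓘(ℝ, E) x p x)) y :=
    (hasFDerivAt_const _ _).prodMk (tangentCoordChange 𝓘(ℝ, E) x p x).hasFDerivAt
  have hcomp := (mfderiv_comp y hchart hι).symm.trans
    (hder.hasMFDerivAt.mfderiv)
  exact congrArg (fun A : E →L[ℝ] E × E => A y) hcomp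

theorem localField_liouville {p : M} {z : E × E} (hz : z ∈ (tangentChart (E := E) p).target) :
    localField (liouville (E := E) (M := M)) p z = localLiouville z := by
  have h := mfderiv_tangentChart_liouville (E := E) p ((tangentChart (E := E) p).symm z).1
    ((tangentChart (E := E) p).symm z).2 ((tangentChart (E := E) p).map_target hz)
  exact h.trans (congrArg localLiouville ((tangentChart (E := E) p).right_inv hz))

theorem localField_projectiveDeformation (S : VField (E := E) M)
    (P : TangentBundle 𝓘(ℝ, E) M → ℝ) {p : M} {z : E × E}
    (hz : z ∈ (tangentChart (E := E) p).target) :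
    localField (projectiveDeformation S P) p z =
      localField S p z - (2 * localFun P p z) • localLiouville z := by
  rw [← localField_liouville hz]
  unfold localField projectiveDeformation
  rw [map_sub, map_smul]
  rfl

theorem IsSpray.isSemisprayOn {S : VField (E := E) M} (hS : IsSpray S) (p : M) :
    IsSemisprayOn (localField S p) (chartDomain E p) where
  contDiffAt _ hz := (hS.smooth p).contDiffAt ((isOpen_chartDomain p).mem_nhds hz)
  fst z hz := congrArg Prod.snd (hS.semispray p z hz)

theorem isDeformationPair_localField {F G : TangentBundle 𝓘(ℝ, E) M → ℝ}
    (hF : IsFinslerFunction F) (hG : IsFinslerFunction G) {S : VField (E := E) M}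
    (hS : IsGeodesicSpray F S) {lam : ℝ}
    (h : GeodesicEquation G (projectiveDeformation S fun u => lam * F u)) (p : M) :
    IsDeformationPair (localField S p)
      (localField (projectiveDeformation S fun u => lam * F u) p) (chartDomain E p)
      (localFun F p) (localFun G p) lam where
  isOpen := isOpen_chartDomain p
  spray := hS.1.isSemisprayOn p
  left := localFun_isHomogeneousOn hF p
  right := localFun_isHomogeneousOn hG p
  eq _ hz := localField_projectiveDeformation S _ hz.1
  geodesic_left := hS.2 p
  geodesic_right := h p

/-- The metric tensor is the vertical Hessian of the energy in the induced chart. -/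
theorem two_mul_metricTensor_apply {F : TangentBundle 𝓘(ℝ, E) M → ℝ}
    (hF : IsFinslerFunction F) (p : M) {y : E}
    (hy : tangentChart (E := E) p (⟨p, y⟩ : TangentBundle 𝓘(ℝ, E) M) ∈ chartDomain E p) (a b : E) :
    2 * metricTensor F p y a b =
      fderiv ℝ (fderiv ℝ fun z => localFun F p z ^ 2)
        (tangentChart (E := E) p (⟨p, y⟩ : TangentBundle 𝓘(ℝ, E) M)) (0, a) (0, b) := by
  set H : E × E → ℝ := fun z => localFun F p z ^ 2 with hH
  set x₀ := extChartAt 𝓘(ℝ, E) p p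
  have hpt : tangentChart (E := E) p (⟨p, y⟩ : TangentBundle 𝓘(ℝ, E) M) = (x₀, y) :=
    tangentChart_mk_self p y
  have hmem : ((x₀, y) : E × E) ∈ chartDomain E p := hpt ▸ hy
  have hfun : (fun w : E => F ⟨p, w⟩ ^ 2) = fun w => H (x₀, w) := by
    funext w
    rw [hH]
    simp only [localFun]
    rw [tangentChart_symm_self]
  have hι : ∀ w : E, HasFDerivAt (fun w : E => ((x₀, w) : E × E))
      (ContinuousLinearMap.inr ℝ E E) w := fun w => hasFDerivAt_prodMk_right x₀ w
  have hHs : ∀ z ∈ chartDomain E p, ContDiffAt ℝ 2 H z := fun z hz =>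
    (((localFun_isHomogeneousOn hF p).contDiffAt z hz).pow 2).of_le two_le_infty
  have hnear : ∀ᶠ w in 𝓝 y, ((x₀, w) : E × E) ∈ chartDomain E p :=
    (hι y).continuousAt.eventually ((isOpen_chartDomain p).mem_nhds hmem)
  have h1 : fderiv ℝ (fun w : E => H (x₀, w)) =ᶠ[𝓝 y]
      fun w => (fderiv ℝ H (x₀, w)).comp (ContinuousLinearMap.inr ℝ E E) := by
    filter_upwards [hnear] with w hw
    exact (((hHs _ hw).differentiableAt (by simp)).hasFDerivAt.comp w (hι w)).fderiv
  have hH' : DifferentiableAt ℝ (fderiv ℝ H) (x₀, y) :=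
    ((hHs _ hmem).fderiv_right (m := 1) (by norm_num)).differentiableAt one_ne_zero
  have h2 : HasFDerivAt
      (fun w => (fderiv ℝ H (x₀, w)).comp (ContinuousLinearMap.inr ℝ E E)) _ y :=
    (hH'.hasFDerivAt.comp y (hι y)).clm_comp
      (hasFDerivAt_const (ContinuousLinearMap.inr ℝ E E) y)
  rw [metricTensor, hfun, h1.fderiv_eq, h2.fderiv, hpt]
  simp

theorem not_isFinslerMetrizable_projectiveDeformation [FiniteDimensional ℝ E]
    (hn : 1 < Module.finrank ℝ E) {F : TangentBundle 𝓘(ℝ, E) M → ℝ} (hF : IsFinslerFunction F)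
    {S : VField (E := E) M} (hS : IsGeodesicSpray F S) {u : TangentBundle 𝓘(ℝ, E) M}
    (hu : u ∈ slashed E M) {lam : ℝ} (hlam : lam ≠ 0)
    (hκ : ∀ κ : ℝ, IsJacobiEigenvalue S u κ → lam ^ 2 * F u ^ 2 + κ ≠ 0) :
    ¬ IsFinslerMetrizable (projectiveDeformation S fun u => lam * F u) := by
  rintro ⟨G, hG, hgeod⟩
  have H := isDeformationPair_localField hF hG hS hgeod u.1
  have hFu : localFun F u.1 (tangentChart (E := E) u.1 u) = F u := by
    rw [localFun, (tangentChart (E := E) u.1).left_inv (mk_mem_tangentChart_source (E := E) u.1 u.2)]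
  obtain ⟨a, ha0, ha⟩ := H.exists_fderiv_fderiv_sq_eq_zero hn hlam
    (tangentChart_mem_chartDomain hu) fun X hX0 hX hΦ => by
      refine hκ _ ⟨X, hX0, hX, hΦ⟩ ?_
      rw [hFu, add_neg_cancel]
  refine ha0 (hF.nondegenerate u hu a fun b => ?_)
  have h := two_mul_metricTensor_apply hF u.1 (tangentChart_mem_chartDomain hu) a b
  rw [ha b] at h
  simpa using h

theorem finite_setOf_isJacobiEigenvalue [FiniteDimensional ℝ E] {S : VField (E := E) M}
    (hS : IsSpray S) {u : TangentBundle 𝓘(ℝ, E) M} (hu : u ∈ slashed E M) :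
    {κ : ℝ | IsJacobiEigenvalue S u κ}.Finite :=
  (hS.isSemisprayOn u.1).finite_jacobi_eigenvalues (isOpen_chartDomain u.1)
    (tangentChart_mem_chartDomain hu)

theorem finite_exceptional [FiniteDimensional ℝ E] {F : TangentBundle 𝓘(ℝ, E) M → ℝ}
    (hF : IsFinslerFunction F) {S : VField (E := E) M} (hS : IsSpray S)
    {u : TangentBundle 𝓘(ℝ, E) M} (hu : u ∈ slashed E M) :
    {lam : ℝ | lam = 0 ∨ ∃ κ : ℝ, IsJacobiEigenvalue S u κ ∧
      lam ^ 2 * F u ^ 2 + κ = 0}.Finite := by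
  have hFu := hF.pos u hu
  refine (Set.finite_singleton (0 : ℝ)).union
    -- Only an inclusion is needed, so the value `0` of `Real.sqrt` at negative arguments, when `κ >
    -- 0`, is harmless.
    (((finite_setOf_isJacobiEigenvalue hS hu).biUnion (t := fun κ =>
      {Real.sqrt (-κ / F u ^ 2), -Real.sqrt (-κ / F u ^ 2)}) fun κ _ => by simp).subset ?_)
  rintro lam ⟨κ, hκ, h⟩
  refine Set.mem_biUnion hκ ?_
  have e : -κ / F u ^ 2 = lam ^ 2 := by
    rw [div_eq_iff (by positivity)]; linarith
  rw [e, Real.sqrt_sq_eq_abs]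
  rcases abs_choice lam with h | h <;> simp [h]

end InducedCharts

end FinslerSpray

end

theorem mainTheorem1
    {E : Type*} [NormedAddCommGroup E] [NormedSpace ℝ E] [FiniteDimensional ℝ E]
    (hn : 1 < Module.finrank ℝ E)
    {M : Type*} [TopologicalSpace M] [ChartedSpace E M] [IsManifold 𝓘(ℝ, E) ∞ M] [Nonempty M]
    (F : TangentBundle 𝓘(ℝ, E) M → ℝ) (hF : FinslerSpray.IsFinslerFunction F)
    (S : FinslerSpray.VField (E := E) M) (hS : FinslerSpray.IsGeodesicSpray F S) :
    {lam : ℝ | FinslerSpray.IsFinslerMetrizable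
        (FinslerSpray.projectiveDeformation S (fun u => lam * F u))}.Finite ∧
    ∀ u ∈ FinslerSpray.slashed E M,
      {lam : ℝ | lam = 0 ∨ ∃ κ : ℝ, FinslerSpray.IsJacobiEigenvalue S u κ ∧
        lam ^ 2 * F u ^ 2 + κ = 0}.Finite ∧
      ∀ lam : ℝ, lam ≠ 0 →
        (∀ κ : ℝ, FinslerSpray.IsJacobiEigenvalue S u κ → lam ^ 2 * F u ^ 2 + κ ≠ 0) →
        ¬ FinslerSpray.IsFinslerMetrizable
          (FinslerSpray.projectiveDeformation S (fun u => lam * F u)) := by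
  refine ⟨?_, fun u hu => ⟨FinslerSpray.finite_exceptional hF hS.1 hu, fun lam hlam hκ =>
    FinslerSpray.not_isFinslerMetrizable_projectiveDeformation hn hF hS hu hlam hκ⟩⟩
  -- A single nonzero tangent vector suffices: its finite exceptional set contains every metrizable
  -- parameter.
  have : Nontrivial E := Module.nontrivial_of_finrank_pos (R := ℝ) (by omega)
  obtain ⟨p⟩ := ‹Nonempty M›
  obtain ⟨y, hy⟩ := exists_ne (0 : E)
  have hu : (⟨p, y⟩ : TangentBundle 𝓘(ℝ, E) M) ∈ FinslerSpray.slashed E M := hy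
  refine (FinslerSpray.finite_exceptional hF hS.1 hu).subset fun lam hmet => ?_
  by_contra hlam
  rw [Set.mem_ofPred_eq, not_or, not_exists] at hlam
  exact FinslerSpray.not_isFinslerMetrizable_projectiveDeformation hn hF hS hu hlam.1
    (fun κ hκ h => hlam.2 κ ⟨hκ, h⟩) hmet
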